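/- Let $\alpha_1<\alpha_2<\alpha_3$ and $\rho_1,\rho_2,\rho_3>0$ be real numbers, and put $$A(x)=\prod_{j=1}^3 (x-\alpha_j),\qquad B(x)=\sum_{j=1}^3 2\rho_j\prod_{i\neq j}(x-\alpha_i).$$ For an integer $k\ge 1$, a Van Vleck zero of order $k$ is a number $\nu\in\mathbb{C}$ such that for some $\mu\in\mathbb{C}$ the Lamé equation $$A(x)\phi''+B(x)\phi'=\mu(x-\nu)\phi$$ has a polynomial solution $\phi\in\mathbb{C}[x]$ of degree exactly $k$. Then for every integer $k\ge 1$ all Van Vleck zeros of order $k$ and of order $k+1$ are real, there are exactly $k+1$ distinct ones of order $k$ and exactly $k+2$ distinct ones of order $k+1$, and if they are written in increasing order as $\nu_1^{(k)}<\cdots<\nu_{k+1}^{(k)}$ and $\nu_1^{(k+1)}<\cdots<\nu_{k+2}^{(k+1)}$, then $$\alpha_1<\nu_1^{(k+1)}<\nu_1^{(k)}<\nu_2^{(k+1)}<\nu_2^{(k)}<\cdots<\nu_{k+1}^{(k)}<\nu_{k+2}^{(k+1)}<\alpha_3 .$$ In particular, between any two distinct Van Vleck zeros of order $k$ there is one of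 order $k+1$, and vice versa. -/

import Mathlib

open Polynomial

/-- The leading coefficient `A(x) = ∏ⱼ (x - αⱼ)` of the Lamé equation. -/
noncomputable def lameA (α : Fin 3 → ℂ) : ℂ[X] :=
  ∏ j, (X - C (α j))

/-- The first-order coefficient `B(x) = ∑ⱼ 2 ρⱼ ∏_{i ≠ j} (x - αᵢ)` of the Lamé equation. -/
noncomputable def lameB (α : Fin 3 → ℂ) (ρ : Fin 3 → ℝ) : ℂ[X] :=
  ∑ j, C (2 * (ρ j : ℂ)) * ∏ i ∈ Finset.univ.erase j, (X - C (α i))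

/-- `φ` solves the Lamé equation `A φ'' + B φ' = μ (x - ν) φ`. -/
def SolvesLame (α : Fin 3 → ℂ) (ρ : Fin 3 → ℝ) (μ ν : ℂ) (φ : ℂ[X]) : Prop :=
  lameA α * derivative (derivative φ) + lameB α ρ * derivative φ = C μ * (X - C ν) * φ

/-- The Van Vleck zeros of order `k`: all `ν` for which, for some `μ`, the Lamé equation
has a polynomial solution of degree exactly `k`. Here `μ`, `ν` and the coefficients of the
solution may be arbitrary complex numbers. -/
def vanVleckZeros (α : Fin 3 → ℂ) (ρ : Fin 3 → ℝ) (k : ℕ) : Set ℂ :=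
  {ν | ∃ (μ : ℂ) (φ : ℂ[X]), φ.degree = k ∧ SolvesLame α ρ μ ν φ}

/-!
Solutions of degree `k` force `μ = k (k - 1 + 2 (ρ₁ + ρ₂ + ρ₃))`, which is positive and increasing
in `k`.

*Existence, reality and number.* In powers of `x - c`, with `c` the *middle* singular point, the
Lamé equation is a three-term recurrence for the coefficients, whose off-diagonal products are
positive up to the index `k` where it breaks off. So the Van Vleck zeros of order `k` are the roots
of the last of a finite family of orthogonal polynomials, and Christoffel–Darboux
(`threeTerm_im_pos`, `threeTerm_wronskian_pos`) makes these real and simple: `lame_spectrum`.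

*Comparison.* Let `w = ∏ |x - αⱼ|^(2ρⱼ)`, so that `w' / w = B / A`. For solutions `φ`, `ψ` with
parameters `(μ, ν)`, `(μ', ν')`, the function `K = w (μ' φ φ' - μ φ² ψ' / ψ)` has derivative
`w ((μ' - μ) φ'² + μ (φ' - φ ψ' / ψ)² + μ μ' φ² (ν' - ν) / A)` and tends to zero at zeros of `φ` and
at singular points. Weighting the two terms by `μ'` and `μ` is what makes the terms in `x / A`, which
have no fixed sign, cancel. Hence if `μ' ≥ μ` and `(ν' - ν) / A ≥ 0` between two adjacent singular
points, and the two equations differ, `ψ` has more zeros there than `φ` (`card_zerosIn_lt`). As `A`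
is positive on the left interval and negative on the right one, raising `ν` favours zeros on the
left and lowering it favours zeros on the right.

*Interlacing.* Within one order `k`, the number of zeros on the left increases strictly with `ν`, and
that on the right decreases strictly; as there are `k + 1` values of `ν` and at most `k` zeros, the
`i`-th solution has exactly `i` zeros on the left and `k - i` on the right (`card_zerosIn_eq`). The
`i`-th solutions of orders `k` and `k + 1` have equally many zeros on the left, so the comparison on
the left excludes `ν'ᵢ ≥ νᵢ`; the `i`-th of order `k` and the `(i + 1)`-st of order `k + 1` have
equally many on the right, which excludes `ν'ᵢ₊₁ ≤ νᵢ`. The bounds by the outer singular points come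
from the monotonicity of `w φ φ'` (`exists_neg_of_lameEq`).
-/

/-! ### Three-term recurrences with positive coefficients -/

/-- The polynomials given by `P₀ = 1`, `P₁ = a₀ X + b₀` and
`Pₙ₊₂ = (aₙ₊₁ X + bₙ₊₁) Pₙ₊₁ - gₙ Pₙ`. -/
noncomputable def threeTerm (a b g : ℕ → ℝ) : ℕ → ℝ[X]
  | 0 => 1
  | 1 => C (a 0) * X + C (b 0)
  | n + 2 => (C (a (n + 1)) * X + C (b (n + 1))) * threeTerm a b g (n + 1)
      - C (g n) * threeTerm a b g n

theorem threeTerm_degree {a : ℕ → ℝ} (ha : ∀ n, 0 < a n) (b g : ℕ → ℝ) (n : ℕ) :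
    (threeTerm a b g n).degree = n := by
  have hlin : ∀ m, (C (a m) * X + C (b m)).degree = 1 := fun m => degree_linear (ha m).ne'
  induction n using Nat.twoStepInduction with
  | zero => simp [threeTerm]
  | one => simpa [threeTerm] using hlin 0
  | more n h0 h1 =>
    have hmain : ((C (a (n + 1)) * X + C (b (n + 1))) * threeTerm a b g (n + 1)).degree
        = ((n + 2 : ℕ) : WithBot ℕ) := by
      rw [degree_mul, hlin, h1, ← Nat.cast_one, ← Nat.cast_add]
      congr 1; omega
    rw [threeTerm, degree_sub_eq_left_of_degree_lt, hmain]
    rw [hmain]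
    refine ((degree_mul_le _ _).trans (add_le_add_left degree_C_le _)).trans_lt ?_
    rw [h0, zero_add]
    exact_mod_cast (by omega : n < n + 2)

/-- The Christoffel–Darboux identity on the pair `(z, conj z)`, in the form of a positivity
statement: the imaginary part of `Pₙ₊₁(z) conj (Pₙ(z))` has the sign of the imaginary part of `z`. -/
theorem threeTerm_im_pos {a b g : ℕ → ℝ} (ha : ∀ n, 0 < a n) {N : ℕ} (hg : ∀ n < N, 0 < g n)
    {z : ℂ} (hz : 0 < z.im) (n : ℕ) (hn : n ≤ N) :
    0 < (aeval z (threeTerm a b g (n + 1)) * starRingEnd ℂ (aeval z (threeTerm a b g n))).im := by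
  induction n with
  | zero => simpa [threeTerm] using mul_pos (ha 0) hz
  | succ n ih =>
    have ih := ih (by omega)
    have hgn := hg n (by omega)
    have hne : 0 < Complex.normSq (aeval z (threeTerm a b g (n + 1))) := by
      rw [Complex.normSq_pos]
      intro h
      simp [h] at ih
    have key : (aeval z (threeTerm a b g (n + 1 + 1)) *
          starRingEnd ℂ (aeval z (threeTerm a b g (n + 1)))).im
        = a (n + 1) * z.im * Complex.normSq (aeval z (threeTerm a b g (n + 1)))
          + g n * (aeval z (threeTerm a b g (n + 1)) *
              starRingEnd ℂ (aeval z (threeTerm a b g n))).im := by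
      rw [threeTerm]
      simp [Complex.normSq_apply]
      ring
    rw [key]
    have := ha (n + 1)
    positivity

/-- The confluent form of `threeTerm_im_pos`, on the diagonal: the Wronskian of consecutive
polynomials is positive. -/
theorem threeTerm_wronskian_pos {a b g : ℕ → ℝ} (ha : ∀ n, 0 < a n) {N : ℕ}
    (hg : ∀ n < N, 0 < g n) (x : ℝ) (n : ℕ) (hn : n ≤ N) :
    0 < (derivative (threeTerm a b g (n + 1))).eval x * (threeTerm a b g n).eval x
      - (threeTerm a b g (n + 1)).eval x * (derivative (threeTerm a b g n)).eval x := by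
  induction n with
  | zero => simpa [threeTerm] using ha 0
  | succ n ih =>
    have ih := ih (by omega)
    have hgn := hg n (by omega)
    have key : (derivative (threeTerm a b g (n + 1 + 1))).eval x *
            (threeTerm a b g (n + 1)).eval x
          - (threeTerm a b g (n + 1 + 1)).eval x * (derivative (threeTerm a b g (n + 1))).eval x
        = a (n + 1) * (threeTerm a b g (n + 1)).eval x ^ 2
          + g n * ((derivative (threeTerm a b g (n + 1))).eval x * (threeTerm a b g n).eval x
      - (threeTerm a b g (n + 1)).eval x * (derivative (threeTerm a b g n)).eval x) := by
      rw [threeTerm]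
      simp
      ring
    rw [key]
    have := ha (n + 1)
    positivity

/-- The roots of the polynomials of a positive three-term recurrence are real and simple. -/
theorem threeTerm_roots {a b g : ℕ → ℝ} (ha : ∀ n, 0 < a n) {N : ℕ}
    (hg : ∀ n < N, 0 < g n) :
    ∃ x : Fin (N + 1) → ℝ, StrictMono x ∧
      ∀ z : ℂ, aeval z (threeTerm a b g (N + 1)) = 0 ↔ z ∈ Set.range (fun i => (x i : ℂ)) := by
  set P := threeTerm a b g (N + 1) with hP
  have hdeg : P.degree = (N + 1 : ℕ) := threeTerm_degree ha b g (N + 1)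
  have hP0 : P ≠ 0 := by
    rw [← degree_ne_bot, hdeg]
    exact WithBot.natCast_ne_bot _
  have hPm0 : P.map (algebraMap ℝ ℂ) ≠ 0 :=
    (Polynomial.map_ne_zero_iff (algebraMap ℝ ℂ).injective).2 hP0
  have hreal : ∀ z : ℂ, aeval z P = 0 → z.im = 0 := by
    intro z hz
    rcases lt_trichotomy z.im 0 with h | h | h
    · have hz' : aeval (starRingEnd ℂ z) P = 0 := by
        rw [aeval_conj, hz, map_zero]
      have := threeTerm_im_pos (b := b) ha hg (z := starRingEnd ℂ z) (by simpa using h) N le_rfl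
      rw [← hP, hz'] at this
      simp at this
    · exact h
    · have := threeTerm_im_pos (b := b) ha hg h N le_rfl
      rw [← hP, hz] at this
      simp at this
  have hmem : ∀ z : ℂ, z ∈ (P.map (algebraMap ℝ ℂ)).roots ↔ aeval z P = 0 := by
    intro z
    rw [mem_roots hPm0, IsRoot.def, eval_map_algebraMap]
  have hnd : (P.map (algebraMap ℝ ℂ)).roots.Nodup := by
    rw [Multiset.nodup_iff_count_le_one]
    intro z
    rw [count_roots]
    by_contra! hlt
    rw [one_lt_rootMultiplicity_iff_isRoot hPm0] at hlt
    obtain ⟨h1, h2⟩ := hlt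
    rw [IsRoot.def, eval_map_algebraMap] at h1
    rw [IsRoot.def, derivative_map, eval_map_algebraMap] at h2
    obtain ⟨x, rfl⟩ : ∃ x : ℝ, (x : ℂ) = z := ⟨z.re, by
      apply Complex.ext <;> simp [hreal z h1]⟩
    have e1 : P.eval x = 0 := by
      have := aeval_algebraMap_apply_eq_algebraMap_eval (A := ℂ) x P
      rw [Complex.coe_algebraMap, h1] at this
      exact_mod_cast this.symm
    have e2 : (derivative P).eval x = 0 := by
      have := aeval_algebraMap_apply_eq_algebraMap_eval (A := ℂ) x (derivative P)
      rw [Complex.coe_algebraMap, h2] at this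
      exact_mod_cast this.symm
    have := threeTerm_wronskian_pos (b := b) ha hg x N le_rfl
    rw [← hP, e1, e2] at this
    simp at this
  have hcard : (P.map (algebraMap ℝ ℂ)).roots.toFinset.card = N + 1 := by
    rw [Multiset.toFinset_card_of_nodup hnd, ← (IsAlgClosed.splits _).natDegree_eq_card_roots,
      natDegree_map, natDegree_eq_of_degree_eq_some hdeg]
  have hcard' : ((P.map (algebraMap ℝ ℂ)).roots.toFinset.image Complex.re).card = N + 1 := by
    rw [Finset.card_image_of_injOn, hcard]
    intro z hz w hw hzw
    simp only [Finset.mem_coe, Multiset.mem_toFinset, hmem] at hz hw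
    exact Complex.ext hzw (by rw [hreal z hz, hreal w hw])
  obtain ⟨S, hS, hSmem⟩ : ∃ S : Finset ℝ, S.card = N + 1 ∧
      ∀ y : ℝ, y ∈ S ↔ ∃ w : ℂ, aeval w P = 0 ∧ w.re = y :=
    ⟨_, hcard', fun y => by simp only [Finset.mem_image, Multiset.mem_toFinset, hmem]⟩
  have hrange : ∀ y : ℝ, y ∈ Set.range (S.orderEmbOfFin hS) ↔
      ∃ w : ℂ, aeval w P = 0 ∧ w.re = y := by
    intro y
    rw [Finset.range_orderEmbOfFin, Finset.mem_coe, hSmem]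
  refine ⟨S.orderEmbOfFin hS, (S.orderEmbOfFin hS).strictMono, fun z => ?_⟩
  constructor
  · intro hz
    obtain ⟨i, hi⟩ := (hrange z.re).2 ⟨z, hz, rfl⟩
    refine ⟨i, ?_⟩
    apply Complex.ext <;> simp [hi, hreal z hz]
  · rintro ⟨i, rfl⟩
    obtain ⟨w, hw, hwi⟩ := (hrange _).1 ⟨i, rfl⟩
    have : w = ((S.orderEmbOfFin hS i : ℝ) : ℂ) := by
      apply Complex.ext <;> simp [hwi, hreal w hw]
    simpa only [← this] using hw

/-! ### The Lamé equation and its coefficient recurrence -/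

/-- The Lamé equation over an arbitrary field, with singular points `c`, `p`, `q` and
exponents `r`, `s`, `t`, written so that the point `c` about which a solution is expanded can be
any of the three. -/
def LameEq {F : Type*} [Field F] (c p q r s t μ ν : F) (φ : F[X]) : Prop :=
  (X - C c) * (X - C p) * (X - C q) * derivative (derivative φ)
    + (C (2 * r) * ((X - C p) * (X - C q)) + C (2 * s) * ((X - C c) * (X - C q))
      + C (2 * t) * ((X - C c) * (X - C p))) * derivative φ = C μ * (X - C ν) * φ

theorem lameEq_swap {F : Type*} [Field F] {c p q r s t μ ν : F} {φ : F[X]}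
    (h : LameEq c p q r s t μ ν φ) : LameEq p c q s r t μ ν φ := by
  unfold LameEq at h ⊢
  rw [← h]; ring

theorem lameEq_rotate {F : Type*} [Field F] {c p q r s t μ ν : F} {φ : F[X]}
    (h : LameEq c p q r s t μ ν φ) : LameEq q c p t r s μ ν φ := by
  unfold LameEq at h ⊢
  rw [← h]; ring

theorem solvesLame_iff (α ρ : Fin 3 → ℝ) (μ ν : ℂ) (φ : ℂ[X]) :
    SolvesLame (fun j => (α j : ℂ)) ρ μ ν φ ↔
      LameEq (α 1 : ℂ) (α 0) (α 2) (ρ 1) (ρ 0) (ρ 2) μ ν φ := by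
  have e0 : Finset.univ.erase (0 : Fin 3) = {1, 2} := by decide
  have e1 : Finset.univ.erase (1 : Fin 3) = {0, 2} := by decide
  have e2 : Finset.univ.erase (2 : Fin 3) = {0, 1} := by decide
  unfold SolvesLame LameEq lameA lameB
  rw [Fin.prod_univ_three, Fin.sum_univ_three, e0, e1, e2,
    Finset.prod_pair (by decide), Finset.prod_pair (by decide), Finset.prod_pair (by decide)]
  constructor <;> intro h <;> rw [← h] <;> ring

theorem lameEq_map {c p q r s t μ ν : ℝ} {φ : ℝ[X]} (h : LameEq c p q r s t μ ν φ) :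
    LameEq (c : ℂ) p q r s t μ ν (φ.map (algebraMap ℝ ℂ)) := by
  unfold LameEq at h ⊢
  have := congrArg (Polynomial.map (algebraMap ℝ ℂ)) h
  simpa [Polynomial.map_mul, Polynomial.map_add, derivative_map] using this

/-- The number `μ` for which the Lamé equation can have solutions of degree `n`, where `σ` is
the sum of the exponents. -/
def lameMu {F : Type*} [Field F] (σ : F) (n : ℕ) : F := n * (n - 1 + 2 * σ)

/-- The coefficient of the `n`-th term in the recurrence for the expansion about `c`, the term with
the highest index. -/
def lameUp {F : Type*} [Field F] (c p q r : F) (n : ℕ) : F :=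
  -((c - p) * (c - q)) * (n * (n - 1 + 2 * r))

/-- The part of the middle coefficient of the recurrence that does not depend on `μ` and `ν`. -/
def lameMid {F : Type*} [Field F] (c p q r s t : F) (n : ℕ) : F :=
  n * ((n - 1) * ((c - p) + (c - q))
    + 2 * r * ((c - p) + (c - q)) + 2 * s * (c - q) + 2 * t * (c - p))

theorem lameEq_iff_coeff {F : Type*} [Field F] (c p q r s t μ ν : F) (φ : F[X]) :
    LameEq c p q r s t μ ν φ ↔
      lameUp c p q r 1 * (taylor c φ).coeff 1 = μ * (ν - c) * (taylor c φ).coeff 0 ∧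
      ∀ n : ℕ, lameUp c p q r (n + 2) * (taylor c φ).coeff (n + 2) =
        (μ * (ν - c) + lameMid c p q r s t (n + 1)) * (taylor c φ).coeff (n + 1)
          - (μ - lameMu (r + s + t) n) * (taylor c φ).coeff n := by
  set f := taylor c φ with hf
  have hd : ∀ ψ : F[X], taylor c (derivative ψ) = derivative (taylor c ψ) := by
    intro ψ
    simp [taylor_apply, derivative_comp]
  have h1 : LameEq c p q r s t μ ν φ ↔
      X * (X + C (c - p)) * (X + C (c - q)) * derivative (derivative f)
    + (C (2 * r) * ((X + C (c - p)) * (X + C (c - q))) + C (2 * s) * (X * (X + C (c - q)))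
      + C (2 * t) * (X * (X + C (c - p)))) * derivative f = C μ * (X + C (c - ν)) * f := by
    unfold LameEq
    rw [← (taylor_injective c).eq_iff]
    simp only [taylor_mul, map_add, map_sub, taylor_X, taylor_C, hd, ← hf]
    constructor <;> intro h
    · linear_combination h
    · linear_combination h
  have h2 : ∀ u v : F, X * (X + C u) * (X + C v) * derivative (derivative f)
    + (C (2 * r) * ((X + C u) * (X + C v)) + C (2 * s) * (X * (X + C v))
      + C (2 * t) * (X * (X + C u))) * derivative f - C μ * (X + C (c - ν)) * f
      = X * (X * (X * derivative (derivative f))) + C (u + v) * (X * (X * derivative (derivative f)))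
        + C (u * v) * (X * derivative (derivative f))
        + C (2 * (r + s + t)) * (X * (X * derivative f))
        + C (2 * r * (u + v) + 2 * s * v + 2 * t * u) * (X * derivative f)
        + C (2 * r * (u * v)) * derivative f
        - C μ * (X * f) - C (μ * (c - ν)) * f := by
    intro u v
    simp only [map_mul, map_add, map_sub]
    ring
  rw [h1, ← sub_eq_zero, h2, Polynomial.ext_iff]
  simp only [coeff_add, coeff_sub, coeff_C_mul, coeff_derivative, coeff_zero]
  constructor
  · intro h
    constructor
    · have := h 0
      simp only [coeff_X_mul_zero, Nat.cast_zero, zero_add] at this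
      simp only [lameUp, Nat.cast_one]
      linear_combination -this
    · intro n
      have := h (n + 1)
      rcases n with _ | _ | n <;>
      · simp only [coeff_X_mul, coeff_X_mul_zero, coeff_derivative] at this
        simp only [Nat.cast_add, Nat.cast_zero,
          Nat.cast_one, Nat.cast_ofNat, zero_add, add_assoc, Nat.reduceAdd] at this
        simp only [lameUp, lameMid, lameMu, Nat.cast_add, Nat.cast_zero,
          Nat.cast_one, Nat.cast_ofNat, zero_add, add_assoc, Nat.reduceAdd]
        linear_combination -this
  · rintro ⟨h0, h⟩ n
    rcases n with _ | n
    · simp only [coeff_X_mul_zero, Nat.cast_zero, zero_add]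
      simp only [lameUp, Nat.cast_one] at h0
      linear_combination -h0
    · have := h n
      rcases n with _ | _ | n <;>
      · simp only [coeff_X_mul, coeff_X_mul_zero, coeff_derivative]
        simp only [Nat.cast_add, Nat.cast_zero,
          Nat.cast_one, Nat.cast_ofNat, zero_add, add_assoc, Nat.reduceAdd]
        simp only [lameUp, lameMid, lameMu, Nat.cast_add, Nat.cast_zero,
          Nat.cast_one, Nat.cast_ofNat, zero_add, add_assoc, Nat.reduceAdd] at this
        linear_combination -this

/-! ### Van Vleck zeros as roots of a polynomial -/

section Spectrum

variable {c p q r s t : ℝ}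

theorem lameUp_pos (hpc : p < c) (hcq : c < q) (hr : 0 < r) (n : ℕ) :
    0 < lameUp c p q r (n + 1) := by
  unfold lameUp
  have h1 : 0 < -((c - p) * (c - q)) := by nlinarith
  have h2 : 0 < ((n + 1 : ℕ) : ℝ) * (((n + 1 : ℕ) : ℝ) - 1 + 2 * r) := by
    push_cast
    have : (0 : ℝ) ≤ n := n.cast_nonneg
    apply mul_pos <;> linarith
  exact mul_pos h1 h2

theorem lameMu_strictMono {σ : ℝ} (hσ : 0 < σ) : StrictMono (lameMu σ) := by
  refine strictMono_nat_of_lt_succ fun n => ?_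
  unfold lameMu
  push_cast
  have : (0 : ℝ) ≤ n := n.cast_nonneg
  nlinarith

theorem lameMu_pos {σ : ℝ} (hσ : 0 < σ) {k : ℕ} (hk : 1 ≤ k) : 0 < lameMu σ k := by
  simpa [lameMu] using lameMu_strictMono hσ (Nat.lt_of_lt_of_le Nat.zero_lt_one hk)

/-- A solution of degree `k` determines `μ`, by comparison of the leading coefficients. -/
theorem lameEq_mu_eq {F : Type*} [Field F] {c p q r s t μ ν : F} {φ : F[X]} {k : ℕ}
    (h : LameEq c p q r s t μ ν φ) (hφ : φ.degree = k) : μ = lameMu (r + s + t) k := by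
  have hdeg : (taylor c φ).natDegree = k := by
    rw [natDegree_taylor, natDegree_eq_of_degree_eq_some hφ]
  have hlead : (taylor c φ).coeff k ≠ 0 := by
    rw [← hdeg, coeff_natDegree, leadingCoeff_ne_zero, Ne, taylor_eq_zero]
    rintro rfl
    simp at hφ
  have := ((lameEq_iff_coeff _ _ _ _ _ _ _ _ _).1 h).2 k
  rw [coeff_eq_zero_of_natDegree_lt (by omega : (taylor c φ).natDegree < k + 2),
    coeff_eq_zero_of_natDegree_lt (by omega : (taylor c φ).natDegree < k + 1)] at this
  have h0 : (μ - lameMu (r + s + t) k) * (taylor c φ).coeff k = 0 := by linear_combination this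
  exact sub_eq_zero.1 ((mul_eq_zero.1 h0).resolve_right hlead)

/-- The polynomials in `ν` that give the coefficients, in powers of `x - c`, of the solution
of the Lamé equation with value `1` at `c`. -/
noncomputable def lameCoeff (c p q r s t μ : ℝ) : ℕ → ℝ[X] :=
  threeTerm (fun n => μ / lameUp c p q r (n + 1))
    (fun n => (lameMid c p q r s t n - μ * c) / lameUp c p q r (n + 1))
    (fun n => (μ - lameMu (r + s + t) n) / lameUp c p q r (n + 2))

theorem lameCoeff_zero (μ : ℝ) : lameCoeff c p q r s t μ 0 = 1 := by
  simp [lameCoeff, threeTerm]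

theorem lameCoeff_one (hU : ∀ n, 0 < lameUp c p q r (n + 1)) (μ : ℝ) :
    C (lameUp c p q r 1) * lameCoeff c p q r s t μ 1 = C μ * (X - C c) := by
  have h1 : C (lameUp c p q r 1) * C (lameUp c p q r 1)⁻¹ = 1 := by
    rw [← C_mul, mul_inv_cancel₀ (hU 0).ne', C_1]
  have h0 : lameMid c p q r s t 0 = 0 := by simp [lameMid]
  simp only [lameCoeff, threeTerm, zero_add, h0, div_eq_mul_inv, C_mul, zero_sub, C_neg]
  linear_combination (C μ * (X - C c)) * h1

theorem lameCoeff_add_two (hU : ∀ n, 0 < lameUp c p q r (n + 1)) (μ : ℝ) (n : ℕ) :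
    C (lameUp c p q r (n + 2)) * lameCoeff c p q r s t μ (n + 2) =
      (C μ * (X - C c) + C (lameMid c p q r s t (n + 1))) * lameCoeff c p q r s t μ (n + 1)
        - C (μ - lameMu (r + s + t) n) * lameCoeff c p q r s t μ n := by
  have h1 : C (lameUp c p q r (n + 2)) * C (lameUp c p q r (n + 2))⁻¹ = 1 := by
    rw [← C_mul, mul_inv_cancel₀ (hU (n + 1)).ne', C_1]
  have e : ∀ m, threeTerm (fun n => μ / lameUp c p q r (n + 1))
    (fun n => (lameMid c p q r s t n - μ * c) / lameUp c p q r (n + 1))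
    (fun n => (μ - lameMu (r + s + t) n) / lameUp c p q r (n + 2)) m
      = lameCoeff c p q r s t μ m := fun _ => rfl
  conv_lhs => rw [lameCoeff, threeTerm]
  simp only [e]
  simp only [div_eq_mul_inv, C_mul, C_sub, add_assoc n 1 1, one_add_one_eq_two]
  linear_combination ((C μ * (X - C c) + C (lameMid c p q r s t (n + 1)))
    * lameCoeff c p q r s t μ (n + 1)
        - (C μ - C (lameMu (r + s + t) n)) * lameCoeff c p q r s t μ n) * h1

theorem coeff_eq_lameCoeff (hU : ∀ n, 0 < lameUp c p q r (n + 1)) {μ : ℝ} {z : ℂ} {φ : ℂ[X]}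
    (h : LameEq (c : ℂ) p q r s t μ z φ) (n : ℕ) :
    (taylor (c : ℂ) φ).coeff n =
      (taylor (c : ℂ) φ).coeff 0 * aeval z (lameCoeff c p q r s t μ n) := by
  have hup : ∀ n, lameUp (c : ℂ) p q r n = (lameUp c p q r n : ℝ) := by
    intro n; simp [lameUp]
  have hmid : ∀ n, lameMid (c : ℂ) p q r s t n = (lameMid c p q r s t n : ℝ) := by
    intro n; simp [lameMid]
  have hmu : ∀ n, lameMu ((r : ℂ) + s + t) n = (lameMu (r + s + t) n : ℝ) := by
    intro n; simp [lameMu]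
  have hU' : ∀ n, ((lameUp c p q r (n + 1) : ℝ) : ℂ) ≠ 0 := fun n => by
    exact_mod_cast (hU n).ne'
  obtain ⟨e1, e2⟩ := (lameEq_iff_coeff _ _ _ _ _ _ _ _ _).1 h
  induction n using Nat.twoStepInduction with
  | zero => simp [lameCoeff_zero]
  | one =>
    apply mul_left_cancel₀ (hU' 0)
    have := congrArg (aeval z) (lameCoeff_one (s := s) (t := t) hU μ)
    simp at this
    rw [hup] at e1
    rw [zero_add]
    linear_combination e1 - (taylor (c : ℂ) φ).coeff 0 * this
  | more n h0 h1 =>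
    apply mul_left_cancel₀ (hU' (n + 1))
    have := congrArg (aeval z) (lameCoeff_add_two (s := s) (t := t) hU μ n)
    simp at this
    have e2 := e2 n
    rw [hup, hmid, hmu, h0, h1] at e2
    rw [add_assoc, one_add_one_eq_two]
    linear_combination e2 - (taylor (c : ℂ) φ).coeff 0 * this

/-- At a root `ν` of the coefficient of order `k + 1`, with `μ` the value for degree `k`, the
expansion breaks off and there is a polynomial solution. -/
theorem exists_lameEq_of_root (hU : ∀ n, 0 < lameUp c p q r (n + 1)) {k : ℕ} (hk : 1 ≤ k)
    {ν : ℝ} (h : (lameCoeff c p q r s t (lameMu (r + s + t) k) (k + 1)).eval ν = 0)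
    (h' : (lameCoeff c p q r s t (lameMu (r + s + t) k) k).eval ν ≠ 0) :
    ∃ φ : ℝ[X], φ.degree = k ∧ LameEq c p q r s t (lameMu (r + s + t) k) ν φ := by
  set μ := lameMu (r + s + t) k with hμ
  set f : ℝ[X] := ∑ n ∈ Finset.range (k + 1),
    C ((lameCoeff c p q r s t μ n).eval ν) * X ^ n with hf
  have hcoeff : ∀ n, f.coeff n =
      if n ≤ k then (lameCoeff c p q r s t μ n).eval ν else 0 := by
    intro n
    rw [hf, finsetSum_coeff]
    simp
  have hdeg : f.degree = k := by
    apply degree_eq_of_le_of_coeff_ne_zero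
    · rw [degree_le_iff_coeff_zero]
      intro m hm
      rw [hcoeff, if_neg (by simpa using hm)]
    · rw [hcoeff, if_pos le_rfl]; exact h'
  have htaylor : taylor c (taylor (-c) f) = f := by
    rw [taylor_taylor]; simp
  refine ⟨taylor (-c) f, by rw [degree_taylor, hdeg], ?_⟩
  rw [lameEq_iff_coeff, htaylor]
  have r1 := congrArg (eval ν) (lameCoeff_one (s := s) (t := t) hU μ)
  have r2 := fun n => congrArg (eval ν) (lameCoeff_add_two (s := s) (t := t) hU μ n)
  simp only [eval_mul, eval_sub, eval_add, eval_C, eval_X] at r1 r2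
  refine ⟨?_, fun n => ?_⟩
  · rw [hcoeff, hcoeff, if_pos hk, if_pos (Nat.zero_le k), r1, lameCoeff_zero]
    simp
  · simp only [hcoeff]
    rcases lt_trichotomy (n + 1) (k + 1) with hn | hn | hn
    · rw [if_pos (by omega : n + 1 ≤ k), if_pos (by omega : n ≤ k)]
      rcases Nat.lt_or_ge (n + 1) k with hn' | hn'
      · rw [if_pos (by omega : n + 2 ≤ k), r2]
      · obtain rfl : k = n + 1 := by omega
        rw [if_neg (by omega), ← r2, h]
    · obtain rfl : n = k := by omega
      simp [hμ]
    · rw [if_neg (by omega), if_neg (by omega), if_neg (by omega)]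
      simp

/-- For every `k` there are exactly `k + 1` numbers `ν` for which the Lamé equation has a
solution of degree `k`; they are real, and so is the solution. The point of expansion `c` is
the middle singular point: only then are the coefficients of the recurrence positive. -/
theorem lame_spectrum (hpc : p < c) (hcq : c < q) (hr : 0 < r) (hσ : 0 < r + s + t) {k : ℕ}
    (hk : 1 ≤ k) :
    ∃ x : Fin (k + 1) → ℝ, StrictMono x ∧
      (∀ z : ℂ, (∃ (μ : ℂ) (φ : ℂ[X]), φ.degree = k ∧ LameEq (c : ℂ) p q r s t μ z φ) ↔
        z ∈ Set.range (fun i => (x i : ℂ))) ∧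
      ∀ i, ∃ φ : ℝ[X], φ.degree = k ∧ LameEq c p q r s t (lameMu (r + s + t) k) (x i) φ := by
  have hU := lameUp_pos hpc hcq hr
  have hμ := lameMu_pos hσ hk
  have hg : ∀ n < k, 0 < (lameMu (r + s + t) k - lameMu (r + s + t) n) / lameUp c p q r (n + 2) :=
    fun n hn => div_pos (sub_pos.2 (lameMu_strictMono hσ hn)) (hU (n + 1))
  have ha : ∀ n, 0 < lameMu (r + s + t) k / lameUp c p q r (n + 1) := fun n => div_pos hμ (hU n)
  obtain ⟨x, hx, hroots⟩ := threeTerm_roots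
    (b := fun n => (lameMid c p q r s t n - lameMu (r + s + t) k * c) / lameUp c p q r (n + 1)) ha hg
  change ∀ z : ℂ, aeval z (lameCoeff c p q r s t (lameMu (r + s + t) k) (k + 1)) = 0 ↔ _ at hroots
  have hsol : ∀ i, ∃ φ : ℝ[X], φ.degree = k ∧
      LameEq c p q r s t (lameMu (r + s + t) k) (x i) φ := by
    intro i
    have h0 : (lameCoeff c p q r s t (lameMu (r + s + t) k) (k + 1)).eval (x i) = 0 := by
      have := aeval_algebraMap_apply_eq_algebraMap_eval (A := ℂ) (x i)
        (lameCoeff c p q r s t (lameMu (r + s + t) k) (k + 1))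
      rw [Complex.coe_algebraMap, (hroots _).2 ⟨i, rfl⟩] at this
      exact_mod_cast this.symm
    refine exists_lameEq_of_root hU hk h0 fun h1 => ?_
    have := threeTerm_wronskian_pos (b := fun n => (lameMid c p q r s t n
      - lameMu (r + s + t) k * c) / lameUp c p q r (n + 1)) ha hg (x i) k le_rfl
    change eval (x i) (lameCoeff c p q r s t (lameMu (r + s + t) k) (k + 1)) = 0 at h0
    change eval (x i) (lameCoeff c p q r s t (lameMu (r + s + t) k) k) = 0 at h1
    unfold lameCoeff at h0 h1
    rw [h0, h1] at this
    simp at this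
  refine ⟨x, hx, fun z => ⟨?_, ?_⟩, hsol⟩
  · rintro ⟨μ, φ, hφ, h⟩
    obtain rfl : μ = (lameMu (r + s + t) k : ℝ) := by
      rw [lameEq_mu_eq h hφ]; simp [lameMu]
    rw [← hroots]
    have hφ0 : taylor (c : ℂ) φ ≠ 0 := by
      rw [Ne, taylor_eq_zero]
      rintro rfl
      simp at hφ
    have hc := coeff_eq_lameCoeff hU h
    have h0 : (taylor (c : ℂ) φ).coeff 0 ≠ 0 := by
      intro h0
      apply hφ0
      ext n
      rw [hc, h0]; simp
    have hk1 : (taylor (c : ℂ) φ).coeff (k + 1) = 0 := by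
      apply coeff_eq_zero_of_natDegree_lt
      rw [natDegree_taylor, natDegree_eq_of_degree_eq_some hφ]; omega
    rw [hc] at hk1
    exact (mul_eq_zero.1 hk1).resolve_left h0
  · rintro ⟨i, rfl⟩
    obtain ⟨φ, hφ, h⟩ := hsol i
    exact ⟨_, _, by rw [degree_map, hφ], lameEq_map h⟩

end Spectrum

/-- A nonzero solution does not vanish at a singular point. -/
theorem lameEq_eval_ne_zero {c p q r s t μ ν : ℝ} {φ : ℝ[X]} (hcp : c ≠ p) (hcq : c ≠ q)
    (hr : 0 < r) (h : LameEq c p q r s t μ ν φ) (hφ : φ ≠ 0) : φ.eval c ≠ 0 := by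
  intro h0
  apply hφ
  rw [← taylor_eq_zero c]
  obtain ⟨e1, e2⟩ := (lameEq_iff_coeff _ _ _ _ _ _ _ _ _).1 h
  have hU : ∀ n, lameUp c p q r (n + 1) ≠ 0 := by
    intro n
    have h1 := sub_ne_zero.2 hcp
    have h2 := sub_ne_zero.2 hcq
    have h3 : ((n + 1 : ℕ) : ℝ) - 1 + 2 * r ≠ 0 := by
      rw [Nat.cast_succ, add_sub_cancel_right]; positivity
    have h4 : ((n + 1 : ℕ) : ℝ) ≠ 0 := by positivity
    unfold lameUp
    simp only [neg_mul, neg_ne_zero]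
    exact mul_ne_zero (mul_ne_zero h1 h2) (mul_ne_zero h4 h3)
  rw [← taylor_coeff_zero] at h0
  ext n
  rw [coeff_zero]
  induction n using Nat.twoStepInduction with
  | zero => exact h0
  | one =>
    rw [h0, mul_zero] at e1
    exact (mul_eq_zero.1 e1).resolve_left (hU 0)
  | more n i0 i1 =>
    have e2 := e2 n
    rw [i0, i1, mul_zero, mul_zero, sub_zero] at e2
    exact (mul_eq_zero.1 e2).resolve_left (hU (n + 1))

/-! ### Comparison of zeros -/

open Filter Topology Set

/-- The weight `|x - c|^(2r) |x - p|^(2s) |x - q|^(2t)`, an integrating factor of the Lamé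
equation: its logarithmic derivative is `B / A`. It vanishes at the singular points. -/
noncomputable def lameWeight (c p q r s t x : ℝ) : ℝ :=
  |x - c| ^ (2 * r) * |x - p| ^ (2 * s) * |x - q| ^ (2 * t)

theorem hasDerivAt_abs_sub_rpow {c x : ℝ} (hx : x ≠ c) (e : ℝ) :
    HasDerivAt (fun y => |y - c| ^ e) (|x - c| ^ e * (e / (x - c))) x := by
  have hx' : x - c ≠ 0 := sub_ne_zero.2 hx
  have hEq : ∀ y, y ≠ c → |y - c| ^ e = Real.exp (Real.log (y - c) * e) := by
    intro y hy
    rw [Real.rpow_def_of_pos (abs_pos.2 (sub_ne_zero.2 hy)), Real.log_abs]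
  have h1 : HasDerivAt (fun y => Real.exp (Real.log (y - c) * e))
      (Real.exp (Real.log (x - c) * e) * (1 / (x - c) * e)) x :=
    ((((hasDerivAt_id x).sub_const c).log hx').mul_const e).exp
  rw [← hEq x hx, show 1 / (x - c) * e = e / (x - c) by ring] at h1
  refine h1.congr_of_eventuallyEq ?_
  filter_upwards [isOpen_ne.mem_nhds hx] with y hy using hEq y hy

section Weight

variable {c p q r s t : ℝ}

theorem lameWeight_pos {x : ℝ} (hc : x ≠ c) (hp : x ≠ p) (hq : x ≠ q) :
    0 < lameWeight c p q r s t x := by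
  have := abs_pos.2 (sub_ne_zero.2 hc)
  have := abs_pos.2 (sub_ne_zero.2 hp)
  have := abs_pos.2 (sub_ne_zero.2 hq)
  unfold lameWeight
  positivity

theorem hasDerivAt_lameWeight {x : ℝ} (hc : x ≠ c) (hp : x ≠ p) (hq : x ≠ q) :
    HasDerivAt (lameWeight c p q r s t)
      (lameWeight c p q r s t x * (2 * r / (x - c) + 2 * s / (x - p) + 2 * t / (x - q))) x := by
  have := ((hasDerivAt_abs_sub_rpow hc (2 * r)).mul (hasDerivAt_abs_sub_rpow hp (2 * s))).mul
    (hasDerivAt_abs_sub_rpow hq (2 * t))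
  refine this.congr_deriv ?_
  simp only [lameWeight, Pi.mul_apply]
  ring

theorem continuous_lameWeight (hr : 0 < r) (hs : 0 < s) (ht : 0 < t) :
    Continuous (lameWeight c p q r s t) := by
  have : ∀ d e : ℝ, 0 < e → Continuous fun x : ℝ => |x - d| ^ (2 * e) := fun d e he =>
    (continuous_abs.comp (continuous_id.sub continuous_const)).rpow_const
      fun _ => Or.inr (by positivity)
  exact ((this c r hr).mul (this p s hs)).mul (this q t ht)

theorem lameWeight_eq_zero (hr : 0 < r) (hs : 0 < s) (ht : 0 < t) {x : ℝ}
    (hx : (x - c) * (x - p) * (x - q) = 0) : lameWeight c p q r s t x = 0 := by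
  have h : ∀ e : ℝ, 0 < e → (0 : ℝ) ^ (2 * e) = 0 := fun e he =>
    Real.zero_rpow (by positivity)
  unfold lameWeight
  rcases mul_eq_zero.1 hx with hx | hx
  · rcases mul_eq_zero.1 hx with hx | hx
    · rw [hx, abs_zero, h r hr]; ring
    · rw [hx, abs_zero, h s hs]; ring
  · rw [hx, abs_zero, h t ht]; ring

/-- The Lamé equation at a regular point, solved for the second derivative. -/
theorem lameEq_eval {μ ν : ℝ} {φ : ℝ[X]} (h : LameEq c p q r s t μ ν φ) {x : ℝ} (hc : x ≠ c)
    (hp : x ≠ p) (hq : x ≠ q) :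
    (derivative (derivative φ)).eval x =
      μ * (x - ν) * φ.eval x / ((x - c) * (x - p) * (x - q))
        - (2 * r / (x - c) + 2 * s / (x - p) + 2 * t / (x - q)) * (derivative φ).eval x := by
  have h' := congrArg (eval x) h
  have := sub_ne_zero.2 hc
  have := sub_ne_zero.2 hp
  have := sub_ne_zero.2 hq
  simp only [eval_add, eval_mul, eval_sub, eval_X, eval_C] at h'
  field_simp
  linear_combination h'

end Weight

/-- Where `φ` vanishes, `φ² ψ' / ψ` tends to zero: the logarithmic derivative has at most a
simple pole. -/
theorem tendsto_sq_mul_logDeriv {φ ψ : ℝ[X]} (hψ : ψ ≠ 0) {a : ℝ} (hφa : φ.eval a = 0) :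
    Tendsto (fun x => φ.eval x ^ 2 * (derivative ψ).eval x / ψ.eval x) (𝓝[≠] a) (𝓝 0) := by
  obtain ⟨f, rfl⟩ := dvd_iff_isRoot.2 hφa
  obtain ⟨g, hg, hgd⟩ := exists_eq_pow_rootMultiplicity_mul_and_not_dvd ψ hψ a
  set m := rootMultiplicity a ψ
  have hga : g.eval a ≠ 0 := fun h => hgd (dvd_iff_isRoot.2 h)
  have hlim : Tendsto (fun x => (x - a) * f.eval x ^ 2 *
      (m + (x - a) * (derivative g).eval x / g.eval x)) (𝓝[≠] a) (𝓝 0) := by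
    have hcont : ContinuousAt (fun x => (x - a) * f.eval x ^ 2 *
      (m + (x - a) * (derivative g).eval x / g.eval x)) a := by
      have h1 := f.continuous.continuousAt (x := a)
      have h2 := g.continuous.continuousAt (x := a)
      have h3 := (derivative g).continuous.continuousAt (x := a)
      fun_prop (disch := exact hga)
    have := hcont.tendsto
    simp only [sub_self, zero_mul] at this
    exact this.mono_left nhdsWithin_le_nhds
  refine hlim.congr' ?_
  filter_upwards [self_mem_nhdsWithin, nhdsWithin_le_nhds
    (g.continuous.continuousAt.eventually_ne hga)] with x hx hgx
  have hxa : x - a ≠ 0 := sub_ne_zero.2 hx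
  have hd : (x - a) * (derivative ψ).eval x =
      (x - a) ^ m * (m * g.eval x + (x - a) * (derivative g).eval x) := by
    rw [hg]
    rcases m with _ | n
    · simp
    · simp [derivative_mul, derivative_X_sub_C_pow]
      ring
  have hv : ψ.eval x = (x - a) ^ m * g.eval x := by
    conv_lhs => rw [hg]
    simp
  rw [hv]
  simp only [eval_mul, eval_sub, eval_X, eval_C]
  have : (x - a) ^ m ≠ 0 := pow_ne_zero _ hxa
  field_simp
  linear_combination (-(f.eval x ^ 2)) * hd

/-- A function on an open interval that is monotone and tends to zero at both ends is zero,
so its derivative vanishes. -/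
theorem deriv_eq_zero_of_nonneg_of_tendsto {a b : ℝ} {K K' : ℝ → ℝ}
    (hK : ∀ x ∈ Ioo a b, HasDerivAt K (K' x) x) (hK' : ∀ x ∈ Ioo a b, 0 ≤ K' x)
    (ha : Tendsto K (𝓝[>] a) (𝓝 0)) (hb : Tendsto K (𝓝[<] b) (𝓝 0)) :
    ∀ x ∈ Ioo a b, K' x = 0 := by
  have hmono : MonotoneOn K (Ioo a b) := by
    apply monotoneOn_of_deriv_nonneg (convex_Ioo a b)
    · exact fun x hx => (hK x hx).continuousAt.continuousWithinAt
    · rw [interior_Ioo]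
      exact fun x hx => (hK x hx).differentiableAt.differentiableWithinAt
    · rw [interior_Ioo]
      exact fun x hx => (hK x hx).deriv ▸ hK' x hx
  have hzero : ∀ x ∈ Ioo a b, K x = 0 := by
    intro x hx
    apply le_antisymm
    · refine ge_of_tendsto hb ?_
      filter_upwards [Ioo_mem_nhdsLT hx.2] with y hy
      exact hmono hx ⟨hx.1.trans hy.1, hy.2⟩ hy.1.le
    · refine le_of_tendsto ha ?_
      filter_upwards [Ioo_mem_nhdsGT hx.1] with y hy
      exact hmono ⟨hy.1, hy.2.trans hx.2⟩ hx hy.2.le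
  intro x hx
  have h0 : HasDerivAt K 0 x := (hasDerivAt_const x (0 : ℝ)).congr_of_eventuallyEq (by
    filter_upwards [isOpen_Ioo.mem_nhds hx] with y hy using hzero y hy)
  exact (hK x hx).unique h0

/-- A polynomial that vanishes on a nonempty open interval is zero. -/
theorem eq_zero_of_eval_Ioo {f : ℝ[X]} {a b : ℝ} (hab : a < b)
    (h : ∀ x ∈ Ioo a b, f.eval x = 0) : f = 0 :=
  eq_zero_of_infinite_isRoot f ((Ioo_infinite hab).mono h)

section Comparison

variable {c p q r s t : ℝ}

theorem ne_of_prod_ne_zero {x : ℝ} (h : (x - c) * (x - p) * (x - q) ≠ 0) :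
    x ≠ c ∧ x ≠ p ∧ x ≠ q := by
  refine ⟨?_, ?_, ?_⟩ <;> rintro rfl <;> simp at h

/-- Comparison theorem. Between two consecutive zeros of a solution `φ` (or singular points)
every solution `ψ` with `μ' ≥ μ`, and with `ν'` shifted from `ν` in the direction given by the
sign of `A`, has a zero. Otherwise `K = w (μ' φ φ' - μ φ² ψ' / ψ)` tends to zero at both ends,
although its derivative is
`w ((μ' - μ) φ'² + μ (φ' - φ ψ' / ψ)² + μ μ' φ² (ν' - ν) / A)`. -/
theorem exists_zero_of_consecutive_zeros (hcp : c ≠ p) (hcq : c ≠ q) (hpq : p ≠ q)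
    (hr : 0 < r) (hs : 0 < s) (ht : 0 < t)
    {μ μ' ν ν' : ℝ} (hμ : 0 < μ) (hμμ' : μ ≤ μ') {φ ψ : ℝ[X]}
    (hφ : LameEq c p q r s t μ ν φ) (hψ : LameEq c p q r s t μ' ν' ψ) (hψ0 : ψ ≠ 0)
    {a b : ℝ} (hab : a < b)
    (hA : ∀ x ∈ Ioo a b, (x - c) * (x - p) * (x - q) ≠ 0)
    (hsign : ∀ x ∈ Ioo a b, 0 ≤ (ν' - ν) / ((x - c) * (x - p) * (x - q)))
    (hφ0 : ∀ x ∈ Ioo a b, φ.eval x ≠ 0)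
    (ha : φ.eval a = 0 ∨ (a - c) * (a - p) * (a - q) = 0)
    (hb : φ.eval b = 0 ∨ (b - c) * (b - p) * (b - q) = 0)
    (hstrict : ν ≠ ν' ∨ μ < μ' ∧ derivative φ ≠ 0) :
    ∃ x ∈ Ioo a b, ψ.eval x = 0 := by
  by_contra! hne
  have hμ' : 0 < μ' := hμ.trans_le hμμ'
  have hsing : ∀ x, (x - c) * (x - p) * (x - q) = 0 → ψ.eval x ≠ 0 := by
    intro x hx
    rcases mul_eq_zero.1 hx with hx | hx
    · rcases mul_eq_zero.1 hx with hx | hx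
      · rw [sub_eq_zero.1 hx]
        exact lameEq_eval_ne_zero hcp hcq hr hψ hψ0
      · rw [sub_eq_zero.1 hx]
        exact lameEq_eval_ne_zero hcp.symm hpq hs (lameEq_swap hψ) hψ0
    · rw [sub_eq_zero.1 hx]
      exact lameEq_eval_ne_zero hcq.symm hpq.symm ht (lameEq_rotate hψ) hψ0
  set w := lameWeight c p q r s t with hw
  have hwc : Continuous w := continuous_lameWeight hr hs ht
  set K : ℝ → ℝ := fun x => w x * (μ' * (φ.eval x * (derivative φ).eval x)
    - μ * (φ.eval x ^ 2 * (derivative ψ).eval x / ψ.eval x)) with hKdef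
  have hlim : ∀ x, (φ.eval x = 0 ∨ (x - c) * (x - p) * (x - q) = 0) →
      Tendsto K (𝓝[≠] x) (𝓝 0) := by
    intro x hx
    by_cases hψx : ψ.eval x = 0
    · have hφx : φ.eval x = 0 := hx.resolve_right fun h => hsing x h hψx
      have h1 := tendsto_sq_mul_logDeriv hψ0 hφx
      have h2 : Tendsto (fun y => φ.eval y * (derivative φ).eval y) (𝓝[≠] x) (𝓝 0) := by
        have := ((φ.continuous.tendsto x).mul ((derivative φ).continuous.tendsto x)).mono_left
          (nhdsWithin_le_nhds (s := {x}ᶜ))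
        simpa only [hφx, zero_mul] using this
      have h3 := (hwc.tendsto x).mono_left (nhdsWithin_le_nhds (s := {x}ᶜ))
      have := h3.mul ((h2.const_mul μ').sub (h1.const_mul μ))
      simpa only [mul_zero, sub_zero] using this
    · have hcont : ContinuousAt K x := by
        have h1 := φ.continuous.continuousAt (x := x)
        have h2 := ψ.continuous.continuousAt (x := x)
        have h3 := (derivative φ).continuous.continuousAt (x := x)
        have h4 := (derivative ψ).continuous.continuousAt (x := x)
        have h5 := hwc.continuousAt (x := x)
        fun_prop (disch := exact hψx)
      have hK0 : K x = 0 := by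
        rcases hx with hx | hx
        · simp [hKdef, hx]
        · simp only [hKdef, hw, lameWeight_eq_zero hr hs ht hx, zero_mul]
      have := hcont.tendsto
      rw [hK0] at this
      exact this.mono_left nhdsWithin_le_nhds
  have hderiv : ∀ x ∈ Ioo a b, HasDerivAt K (w x * ((μ' - μ) * (derivative φ).eval x ^ 2
      + μ * ((derivative φ).eval x - φ.eval x * (derivative ψ).eval x / ψ.eval x) ^ 2
      + μ * μ' * φ.eval x ^ 2 * ((ν' - ν) / ((x - c) * (x - p) * (x - q))))) x := by
    intro x hx
    obtain ⟨hxc, hxp, hxq⟩ := ne_of_prod_ne_zero (hA x hx)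
    have hψx := hne x hx
    have hAx := hA x hx
    have d1 := φ.hasDerivAt x
    have d2 := ψ.hasDerivAt x
    have d3 := (derivative φ).hasDerivAt x
    have d4 := (derivative ψ).hasDerivAt x
    have d5 : HasDerivAt w _ x := hasDerivAt_lameWeight hxc hxp hxq
    refine (d5.mul (((d1.mul d3).const_mul μ').sub
      ((((d1.pow 2).mul d4).div d2 hψx).const_mul μ))).congr_deriv ?_
    rw [lameEq_eval hφ hxc hxp hxq, lameEq_eval hψ hxc hxp hxq]
    simp only [Pi.mul_apply, Pi.pow_apply, Pi.div_apply, Pi.sub_apply]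
    generalize 2 * r / (x - c) + 2 * s / (x - p) + 2 * t / (x - q) = Λ
    generalize (x - c) * (x - p) * (x - q) = A at hAx
    rw [← hw]
    field_simp
    ring
  have hnonneg1 : ∀ x, 0 ≤ (μ' - μ) * (derivative φ).eval x ^ 2 := fun x =>
    mul_nonneg (sub_nonneg.2 hμμ') (sq_nonneg _)
  have hnonneg2 : ∀ x, 0 ≤ μ * ((derivative φ).eval x
      - φ.eval x * (derivative ψ).eval x / ψ.eval x) ^ 2 := fun x =>
    mul_nonneg hμ.le (sq_nonneg _)
  have hnonneg3 : ∀ x ∈ Ioo a b,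
      0 ≤ μ * μ' * φ.eval x ^ 2 * ((ν' - ν) / ((x - c) * (x - p) * (x - q))) := fun x hx =>
    mul_nonneg (by positivity) (hsign x hx)
  have hwpos : ∀ x ∈ Ioo a b, 0 < w x := fun x hx => by
    obtain ⟨hxc, hxp, hxq⟩ := ne_of_prod_ne_zero (hA x hx)
    exact lameWeight_pos hxc hxp hxq
  have hzero := deriv_eq_zero_of_nonneg_of_tendsto hderiv
    (fun x hx => mul_nonneg (hwpos x hx).le
      (add_nonneg (add_nonneg (hnonneg1 x) (hnonneg2 x)) (hnonneg3 x hx)))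
    ((hlim a ha).mono_left (nhdsWithin_mono _ fun _ h => ne_of_gt h))
    ((hlim b hb).mono_left (nhdsWithin_mono _ fun _ h => ne_of_lt h))
  have hsum := fun x hx => (mul_eq_zero.1 (hzero x hx)).resolve_left (hwpos x hx).ne'
  rcases hstrict with hν | ⟨hlt, hφ'⟩
  · obtain ⟨x, hx⟩ := nonempty_Ioo.2 hab
    have h0 : μ * μ' * φ.eval x ^ 2 * ((ν' - ν) / ((x - c) * (x - p) * (x - q))) = 0 := by
      linarith [hsum x hx, hnonneg1 x, hnonneg2 x, hnonneg3 x hx]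
    have := hφ0 x hx
    have := hA x hx
    have := sub_ne_zero.2 hν.symm
    have hne0 : μ * μ' * φ.eval x ^ 2 * ((ν' - ν) / ((x - c) * (x - p) * (x - q))) ≠ 0 := by
      positivity
    exact hne0 h0
  · refine hφ' (eq_zero_of_eval_Ioo hab fun x hx => ?_)
    have h0 : (μ' - μ) * (derivative φ).eval x ^ 2 = 0 := by
      linarith [hsum x hx, hnonneg1 x, hnonneg2 x, hnonneg3 x hx]
    exact pow_eq_zero_iff two_ne_zero |>.1 ((mul_eq_zero.1 h0).resolve_left (sub_pos.2 hlt).ne')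

/-- If a nonconstant solution exists, `(x - ν) / A` takes a negative value between any two adjacent
singular points: otherwise `w φ φ'` would be monotone there, with the value zero at both ends. -/
theorem exists_neg_of_lameEq (hr : 0 < r) (hs : 0 < s) (ht : 0 < t)
    {μ ν : ℝ} (hμ : 0 < μ) {φ : ℝ[X]} (hφ : LameEq c p q r s t μ ν φ) (hφ' : derivative φ ≠ 0)
    {a b : ℝ} (hab : a < b)
    (hA : ∀ x ∈ Ioo a b, (x - c) * (x - p) * (x - q) ≠ 0)
    (ha : (a - c) * (a - p) * (a - q) = 0) (hb : (b - c) * (b - p) * (b - q) = 0) :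
    ∃ x ∈ Ioo a b, (x - ν) / ((x - c) * (x - p) * (x - q)) < 0 := by
  by_contra! hsign
  set w := lameWeight c p q r s t with hw
  have hcont : Continuous fun x => w x * (φ.eval x * (derivative φ).eval x) :=
    (continuous_lameWeight hr hs ht).mul (φ.continuous.mul (derivative φ).continuous)
  have hlim : ∀ x, (x - c) * (x - p) * (x - q) = 0 →
      Tendsto (fun x => w x * (φ.eval x * (derivative φ).eval x)) (𝓝 x) (𝓝 0) := by
    intro x hx
    have := hcont.tendsto x
    simpa only [hw, lameWeight_eq_zero hr hs ht hx, zero_mul] using this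
  have hderiv : ∀ x ∈ Ioo a b, HasDerivAt (fun x => w x * (φ.eval x * (derivative φ).eval x))
      (w x * ((derivative φ).eval x ^ 2
        + μ * φ.eval x ^ 2 * ((x - ν) / ((x - c) * (x - p) * (x - q))))) x := by
    intro x hx
    obtain ⟨hxc, hxp, hxq⟩ := ne_of_prod_ne_zero (hA x hx)
    have d5 : HasDerivAt w _ x := hasDerivAt_lameWeight hxc hxp hxq
    refine (d5.mul ((φ.hasDerivAt x).mul ((derivative φ).hasDerivAt x))).congr_deriv ?_
    rw [lameEq_eval hφ hxc hxp hxq]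
    simp only [Pi.mul_apply]
    rw [← hw]
    ring
  have hnonneg : ∀ x ∈ Ioo a b,
      0 ≤ μ * φ.eval x ^ 2 * ((x - ν) / ((x - c) * (x - p) * (x - q))) := fun x hx =>
    mul_nonneg (by positivity) (hsign x hx)
  have hwpos : ∀ x ∈ Ioo a b, 0 < w x := fun x hx => by
    obtain ⟨hxc, hxp, hxq⟩ := ne_of_prod_ne_zero (hA x hx)
    exact lameWeight_pos hxc hxp hxq
  have hzero := deriv_eq_zero_of_nonneg_of_tendsto hderiv
    (fun x hx => mul_nonneg (hwpos x hx).le (add_nonneg (sq_nonneg _) (hnonneg x hx)))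
    ((hlim a ha).mono_left nhdsWithin_le_nhds) ((hlim b hb).mono_left nhdsWithin_le_nhds)
  refine hφ' (eq_zero_of_eval_Ioo hab fun x hx => ?_)
  have hsum := (mul_eq_zero.1 (hzero x hx)).resolve_left (hwpos x hx).ne'
  have h0 : (derivative φ).eval x ^ 2 = 0 := by
    linarith [hnonneg x hx, sq_nonneg ((derivative φ).eval x)]
  exact pow_eq_zero_iff two_ne_zero |>.1 h0

end Comparison

/-! ### Counting zeros -/

/-- If `T` meets every gap of the finite set `S` in `(l, r)`, the two outer gaps included, then
`T` has at least one more element than `S`. -/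
theorem card_add_one_le_of_gaps {l r : ℝ} (hlr : l < r) {S T : Finset ℝ}
    (hS : ∀ x ∈ S, x ∈ Ioo l r)
    (h : ∀ a b, a < b → (a = l ∨ a ∈ S) → (b = r ∨ b ∈ S) → (∀ x ∈ S, x ∉ Ioo a b) →
      ∃ x ∈ T, x ∈ Ioo a b) : S.card + 1 ≤ T.card := by
  have hl : l ∉ S := fun hl => lt_irrefl l (hS l hl).1
  rw [← Finset.card_insert_of_notMem hl]
  have hgap : ∀ a : ℝ, a = l ∨ a ∈ S → ∃ y ∈ T, a < y ∧ ∀ a', a' = l ∨ a' ∈ S → a < a' → y < a' := by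
    intro a ha
    have har : a < r := ha.elim (fun h => h ▸ hlr) (fun h => (hS a h).2)
    -- the next element of `S` after `a`, or else `r`
    have hne : (insert r (S.filter (a < ·))).Nonempty := Finset.insert_nonempty _ _
    set b := (insert r (S.filter (a < ·))).min' hne with hb
    have hbmem := Finset.min'_mem _ hne
    rw [← hb, Finset.mem_insert, Finset.mem_filter] at hbmem
    have hmin : ∀ x ∈ S, a < x → b ≤ x := fun x hx hax =>
      Finset.min'_le _ _ (Finset.mem_insert_of_mem (Finset.mem_filter.2 ⟨hx, hax⟩))
    have hab : a < b := hbmem.elim (fun h => h ▸ har) (fun h => h.2)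
    obtain ⟨y, hyT, hy⟩ := h a b hab ha (hbmem.imp_right And.left)
      fun x hx hxab => (hmin x hx hxab.1).not_gt hxab.2
    refine ⟨y, hyT, hy.1, fun a' ha' haa' => ?_⟩
    rcases ha' with rfl | ha'
    · rcases ha with rfl | ha
      · exact absurd haa' (lt_irrefl _)
      · exact absurd ((hS a ha).1.trans haa') (lt_irrefl _)
    · exact hy.2.trans_le (hmin a' ha' haa')
  choose! f hfT hf1 hf2 using hgap
  refine Finset.card_le_card_of_injOn f (fun a ha => hfT a (Finset.mem_insert.1 ha)) ?_
  intro a ha a' ha' heq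
  have ha := Finset.mem_insert.1 (Finset.mem_coe.1 ha)
  have ha' := Finset.mem_insert.1 (Finset.mem_coe.1 ha')
  rcases lt_trichotomy a a' with hlt | h | hlt
  · exact absurd heq (((hf2 a ha a' ha' hlt).trans (hf1 a' ha')).ne)
  · exact h
  · exact absurd heq (((hf2 a' ha' a ha hlt).trans (hf1 a ha)).ne')

/-- The set of zeros of `φ` in the open interval `(l, r)`. -/
noncomputable def zerosIn (φ : ℝ[X]) (l r : ℝ) : Finset ℝ :=
  φ.roots.toFinset.filter (· ∈ Ioo l r)

theorem mem_zerosIn {φ : ℝ[X]} (hφ : φ ≠ 0) {l r x : ℝ} :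
    x ∈ zerosIn φ l r ↔ φ.eval x = 0 ∧ x ∈ Ioo l r := by
  simp [zerosIn, hφ]

theorem card_zerosIn_add_card_zerosIn_le (φ : ℝ[X]) (l m r : ℝ) :
    (zerosIn φ l m).card + (zerosIn φ m r).card ≤ φ.natDegree := by
  have hdisj : Disjoint (zerosIn φ l m) (zerosIn φ m r) := by
    rw [Finset.disjoint_left]
    intro x hx hx'
    simp only [zerosIn, Finset.mem_filter, mem_Ioo] at hx hx'
    exact lt_irrefl x (hx.2.2.trans hx'.2.1)
  rw [← Finset.card_union_of_disjoint hdisj]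
  refine (Finset.card_le_card ?_).trans ((Multiset.toFinset_card_le _).trans (card_roots' φ))
  exact Finset.union_subset (Finset.filter_subset _ _) (Finset.filter_subset _ _)

section Zeros

variable {c p q r s t : ℝ}

/-- Sturm comparison between two adjacent singular points `l` and `u`. -/
theorem card_zerosIn_lt (hcp : c ≠ p) (hcq : c ≠ q) (hpq : p ≠ q)
    (hr : 0 < r) (hs : 0 < s) (ht : 0 < t)
    {μ μ' ν ν' : ℝ} (hμ : 0 < μ) (hμμ' : μ ≤ μ') {φ ψ : ℝ[X]}
    (hφ : LameEq c p q r s t μ ν φ) (hψ : LameEq c p q r s t μ' ν' ψ) (hφ0 : φ ≠ 0) (hψ0 : ψ ≠ 0)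
    {l u : ℝ} (hlu : l < u)
    (hA : ∀ x ∈ Ioo l u, (x - c) * (x - p) * (x - q) ≠ 0)
    (hsign : ∀ x ∈ Ioo l u, 0 ≤ (ν' - ν) / ((x - c) * (x - p) * (x - q)))
    (hl : (l - c) * (l - p) * (l - q) = 0) (hu : (u - c) * (u - p) * (u - q) = 0)
    (hstrict : ν ≠ ν' ∨ μ < μ' ∧ derivative φ ≠ 0) :
    (zerosIn φ l u).card < (zerosIn ψ l u).card := by
  refine card_add_one_le_of_gaps hlu (fun x hx => ((mem_zerosIn hφ0).1 hx).2) ?_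
  intro a b hab ha hb hgap
  have hla : l ≤ a := ha.elim (fun h => h.ge) fun h => ((mem_zerosIn hφ0).1 h).2.1.le
  have hbu : b ≤ u := hb.elim (fun h => h.le) fun h => ((mem_zerosIn hφ0).1 h).2.2.le
  have hsub : Ioo a b ⊆ Ioo l u := Ioo_subset_Ioo hla hbu
  obtain ⟨x, hx, hx0⟩ := exists_zero_of_consecutive_zeros hcp hcq hpq hr hs ht hμ hμμ' hφ hψ hψ0
    hab (fun x hx => hA x (hsub hx)) (fun x hx => hsign x (hsub hx))
    (fun x hx h0 => hgap x ((mem_zerosIn hφ0).2 ⟨h0, hsub hx⟩) hx)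
    (ha.elim (fun h => Or.inr (h ▸ hl)) fun h => Or.inl ((mem_zerosIn hφ0).1 h).1)
    (hb.elim (fun h => Or.inr (h ▸ hu)) fun h => Or.inl ((mem_zerosIn hφ0).1 h).1) hstrict
  exact ⟨x, (mem_zerosIn hψ0).2 ⟨hx0, hsub hx⟩, hx⟩

theorem prod_pos_left {x : ℝ} (hcq : c < q) (hx : x ∈ Ioo p c) :
    0 < (x - c) * (x - p) * (x - q) := by
  have h1 : 0 < c - x := sub_pos.2 hx.2
  have h2 : 0 < x - p := sub_pos.2 hx.1
  have h3 : 0 < q - x := by linarith [hx.2]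
  nlinarith [mul_pos (mul_pos h1 h2) h3]

theorem prod_neg_right {x : ℝ} (hpc : p < c) (hx : x ∈ Ioo c q) :
    (x - c) * (x - p) * (x - q) < 0 := by
  have h1 : 0 < x - c := sub_pos.2 hx.1
  have h2 : 0 < x - p := by linarith [hx.1]
  have h3 : 0 < q - x := sub_pos.2 hx.2
  nlinarith [mul_pos (mul_pos h1 h2) h3]

theorem card_zerosIn_lt_left (hpc : p < c) (hcq : c < q)
    (hr : 0 < r) (hs : 0 < s) (ht : 0 < t)
    {μ μ' ν ν' : ℝ} (hμ : 0 < μ) (hμμ' : μ ≤ μ') (hνν' : ν ≤ ν') {φ ψ : ℝ[X]}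
    (hφ : LameEq c p q r s t μ ν φ) (hψ : LameEq c p q r s t μ' ν' ψ) (hφ0 : φ ≠ 0) (hψ0 : ψ ≠ 0)
    (hstrict : ν ≠ ν' ∨ μ < μ' ∧ derivative φ ≠ 0) :
    (zerosIn φ p c).card < (zerosIn ψ p c).card :=
  card_zerosIn_lt hpc.ne' hcq.ne (hpc.trans hcq).ne hr hs ht hμ hμμ' hφ hψ hφ0 hψ0 hpc
    (fun _ hx => (prod_pos_left hcq hx).ne')
    (fun _ hx => div_nonneg (sub_nonneg.2 hνν') (prod_pos_left hcq hx).le)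
    (by ring) (by ring) hstrict

theorem card_zerosIn_lt_right (hpc : p < c) (hcq : c < q)
    (hr : 0 < r) (hs : 0 < s) (ht : 0 < t)
    {μ μ' ν ν' : ℝ} (hμ : 0 < μ) (hμμ' : μ ≤ μ') (hνν' : ν' ≤ ν) {φ ψ : ℝ[X]}
    (hφ : LameEq c p q r s t μ ν φ) (hψ : LameEq c p q r s t μ' ν' ψ) (hφ0 : φ ≠ 0) (hψ0 : ψ ≠ 0)
    (hstrict : ν ≠ ν' ∨ μ < μ' ∧ derivative φ ≠ 0) :
    (zerosIn φ c q).card < (zerosIn ψ c q).card :=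
  card_zerosIn_lt hpc.ne' hcq.ne (hpc.trans hcq).ne hr hs ht hμ hμμ' hφ hψ hφ0 hψ0 hcq
    (fun _ hx => (prod_neg_right hpc hx).ne)
    (fun _ hx => div_nonneg_of_nonpos (sub_nonpos.2 hνν') (prod_neg_right hpc hx).le)
    (by ring) (by ring) hstrict

/-- Oscillation theorem: the solution for the `i`-th Van Vleck zero (counted from `0`) of order `k`
has `i` zeros in the left and `k - i` zeros in the right interval. By comparison the first number is
strictly increasing and the second strictly decreasing in `i`, and their sum is at most `k`. -/
theorem card_zerosIn_eq (hpc : p < c) (hcq : c < q)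
    (hr : 0 < r) (hs : 0 < s) (ht : 0 < t) {k : ℕ} {μ : ℝ} (hμ : 0 < μ)
    {x : Fin (k + 1) → ℝ} (hx : StrictMono x) {φ : Fin (k + 1) → ℝ[X]}
    (hdeg : ∀ i, (φ i).degree = k) (hφ : ∀ i, LameEq c p q r s t μ (x i) (φ i)) (i : Fin (k + 1)) :
    (zerosIn (φ i) p c).card = i ∧ (zerosIn (φ i) c q).card = k - i := by
  have hφ0 : ∀ i, φ i ≠ 0 := fun i h => by
    have := hdeg i
    rw [h] at this
    simp at this
  have hL : StrictMono fun i => (zerosIn (φ i) p c).card := fun i j hij =>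
    card_zerosIn_lt_left hpc hcq hr hs ht hμ le_rfl (hx hij).le (hφ i) (hφ j) (hφ0 i) (hφ0 j)
      (Or.inl (hx hij).ne)
  have hR : StrictAnti fun i => (zerosIn (φ i) c q).card := fun i j hij =>
    card_zerosIn_lt_right hpc hcq hr hs ht hμ le_rfl (hx hij).le (hφ j) (hφ i) (hφ0 j) (hφ0 i)
      (Or.inl (hx hij).ne')
  have hLi : ∀ n (hn : n < k + 1), n ≤ (zerosIn (φ ⟨n, hn⟩) p c).card := by
    intro n
    induction n with
    | zero => simp
    | succ n ih =>
      intro hn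
      have h1 := ih (by omega)
      have h2 := hL (show (⟨n, by omega⟩ : Fin (k + 1)) < ⟨n + 1, hn⟩ by simp [Fin.lt_def])
      simp only at h2
      omega
  have hRi : ∀ n (hn : n < k + 1), n ≤ (zerosIn (φ ⟨k - n, by omega⟩) c q).card := by
    intro n
    induction n with
    | zero => simp
    | succ n ih =>
      intro hn
      have h1 := ih (by omega)
      have h2 := hR (show (⟨k - (n + 1), by omega⟩ : Fin (k + 1)) < ⟨k - n, by omega⟩ by
        simp only [Fin.lt_def]; omega)
      simp only at h2
      omega
  have h1 := hLi i i.2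
  have h2 := hRi (k - i) (by omega)
  have hi : (⟨k - (k - i), by omega⟩ : Fin (k + 1)) = i := by ext; simp only; omega
  rw [hi] at h2
  have h3 := card_zerosIn_add_card_zerosIn_le (φ i) p c q
  rw [natDegree_eq_of_degree_eq_some (hdeg i)] at h3
  have := i.2
  simp only [Fin.eta] at h1
  omega

end Zeros

/-! ### Interlacing -/

theorem theorem2p1 (α ρ : Fin 3 → ℝ) (hα₁₂ : α 0 < α 1) (hα₂₃ : α 1 < α 2)
    (hρ : ∀ j, 0 < ρ j) (k : ℕ) (hk : 1 ≤ k) :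
    ∃ (ν : Fin (k + 1) → ℝ) (ν' : Fin (k + 2) → ℝ),
      StrictMono ν ∧ StrictMono ν' ∧
      vanVleckZeros (fun j => (α j : ℂ)) ρ k = Set.range (fun i => (ν i : ℂ)) ∧
      vanVleckZeros (fun j => (α j : ℂ)) ρ (k + 1) = Set.range (fun i => (ν' i : ℂ)) ∧
      α 0 < ν' 0 ∧
      (∀ i : Fin (k + 1), ν' i.castSucc < ν i ∧ ν i < ν' i.succ) ∧
      ν' (Fin.last (k + 1)) < α 2 := by
  have hσ : 0 < ρ 1 + ρ 0 + ρ 2 := add_pos (add_pos (hρ 1) (hρ 0)) (hρ 2)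
  have hk' : 1 ≤ k + 1 := by omega
  obtain ⟨ν, hν, hspec, hsol⟩ := lame_spectrum (s := ρ 0) (t := ρ 2) hα₁₂ hα₂₃ (hρ 1) hσ hk
  obtain ⟨ν', hν', hspec', hsol'⟩ := lame_spectrum (s := ρ 0) (t := ρ 2) hα₁₂ hα₂₃ (hρ 1) hσ hk'
  choose φ hφd hφ using hsol
  choose ψ hψd hψ using hsol'
  have hset : ∀ (n : ℕ) (x : Fin (n + 1) → ℝ),
      (∀ z : ℂ, (∃ (μ : ℂ) (φ : ℂ[X]), φ.degree = n ∧
        LameEq (α 1 : ℂ) (α 0) (α 2) (ρ 1) (ρ 0) (ρ 2) μ z φ) ↔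
          z ∈ Set.range (fun i => (x i : ℂ))) →
      vanVleckZeros (fun j => (α j : ℂ)) ρ n = Set.range (fun i => (x i : ℂ)) := by
    intro n x h
    ext z
    rw [← h]
    simp only [vanVleckZeros, solvesLame_iff, Set.mem_ofPred_eq]
  have hμ := lameMu_pos hσ hk
  have hμ' := lameMu_pos hσ hk'
  have hμμ' : lameMu (ρ 1 + ρ 0 + ρ 2) k < lameMu (ρ 1 + ρ 0 + ρ 2) (k + 1) :=
    lameMu_strictMono hσ k.lt_succ_self
  have hne : ∀ {n : ℕ} {f : ℝ[X]}, 1 ≤ n → f.degree = n → f ≠ 0 ∧ derivative f ≠ 0 := by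
    intro n f hn hf
    refine ⟨fun h => by simp [h] at hf, fun h => ?_⟩
    have := derivative_eq_zero.1 h
    rw [natDegree_eq_of_degree_eq_some hf] at this
    omega
  have hcount := card_zerosIn_eq hα₁₂ hα₂₃ (hρ 1) (hρ 0) (hρ 2) hμ hν hφd hφ
  have hcount' := card_zerosIn_eq hα₁₂ hα₂₃ (hρ 1) (hρ 0) (hρ 2) hμ' hν' hψd hψ
  refine ⟨ν, ν', hν, hν', hset k ν hspec, hset (k + 1) ν' hspec', ?_, fun i => ⟨?_, ?_⟩, ?_⟩
  · obtain ⟨x, hx, hneg⟩ := exists_neg_of_lameEq (hρ 1) (hρ 0) (hρ 2) hμ' (hψ 0)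
      (hne hk' (hψd 0)).2 hα₁₂ (fun x hx => (prod_pos_left hα₂₃ hx).ne') (by ring) (by ring)
    have := (div_neg_iff.1 hneg).resolve_left fun h => h.2.not_gt (prod_pos_left hα₂₃ hx)
    linarith [hx.1, this.1]
  · -- both solutions have `i` zeros in the left interval
    by_contra! hle
    have := card_zerosIn_lt_left hα₁₂ hα₂₃ (hρ 1) (hρ 0) (hρ 2) hμ hμμ'.le hle (hφ i)
      (hψ i.castSucc) (hne hk (hφd i)).1 (hne hk' (hψd _)).1 (Or.inr ⟨hμμ', (hne hk (hφd i)).2⟩)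
    rw [(hcount i).1, (hcount' i.castSucc).1] at this
    simp at this
  · -- both solutions have `k - i` zeros in the right interval
    by_contra! hle
    have := card_zerosIn_lt_right hα₁₂ hα₂₃ (hρ 1) (hρ 0) (hρ 2) hμ hμμ'.le hle (hφ i)
      (hψ i.succ) (hne hk (hφd i)).1 (hne hk' (hψd _)).1 (Or.inr ⟨hμμ', (hne hk (hφd i)).2⟩)
    rw [(hcount i).2, (hcount' i.succ).2] at this
    simp at this
  · obtain ⟨x, hx, hneg⟩ := exists_neg_of_lameEq (hρ 1) (hρ 0) (hρ 2) hμ' (hψ (Fin.last (k + 1)))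
      (hne hk' (hψd _)).2 hα₂₃ (fun x hx => (prod_neg_right hα₁₂ hx).ne) (by ring) (by ring)
    have := (div_neg_iff.1 hneg).resolve_right fun h => h.2.not_gt (prod_neg_right hα₁₂ hx)
    linarith [hx.2, this.1]
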